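/- Let $n\in\mathbb N$, $\alpha\in(0,1)$, let $\mathbf v\in\mathbb R^n$ be stochastic (i.e. $\mathbf v\ge 0$ and $\mathbf 1^\top\mathbf v=1$), and let $R\in\mathbb R^{n\times n^2}$ satisfy $R\ge 0$ and $\mathbf 1_n^\top R=\mathbf 1_{n^2}^\top$. Here $\mathbf 1$ is the all-ones vector and inequalities between vectors and matrices are entrywise. Consider the multilinear PageRank equation $$\mathbf x=\alpha R(\mathbf x\otimes\mathbf x)+(1-\alpha)\mathbf v,\qquad \mathbf x\in\mathbb R^n. \tag{$*$}$$ Then $(*)$ has a (necessarily unique) minimal nonnegative solution $\mathbf m$, that is, a solution $\mathbf m\ge 0$ such that $\mathbf m\le\mathbf x$ for every solution $\mathbf x\ge 0$ of $(*)$. Moreover: - (Subcritical case) If $\alpha\le\frac12$, then $\mathbf m$ is stochastic, and it is the unique stochastic solution of $(*)$. - (Supercritical case) If $\alpha>\frac12$, then $\mathbf 1^\top\mathbf m=\frac{1-\alpha}{\alpha}<1$, and $(*)$ has at least one stochastic solution $\mathbf s$ with $\mathbf s\ge\mathbf m$. -/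

import Mathlib

open scoped Matrix

namespace MultilinearPageRank

/-- The Kronecker product `x ⊗ y` of two vectors of length `n`. The `n ^ 2` entries are indexed by
pairs, as for the Kronecker product of matrices in Mathlib. -/
def kronVec {n : ℕ} (x y : Fin n → ℝ) : Fin n × Fin n → ℝ := fun p => x p.1 * y p.2

/-- The map `G(x) = α R (x ⊗ x) + (1 - α) v`. -/
def G {n : ℕ} (α : ℝ) (R : Matrix (Fin n) (Fin n × Fin n) ℝ) (v : Fin n → ℝ)
    (x : Fin n → ℝ) : Fin n → ℝ :=
  α • (R *ᵥ kronVec x x) + (1 - α) • v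

/-- `x` solves the multilinear PageRank equation `x = α R (x ⊗ x) + (1 - α) v`. -/
def IsSolution {n : ℕ} (α : ℝ) (R : Matrix (Fin n) (Fin n × Fin n) ℝ) (v : Fin n → ℝ)
    (x : Fin n → ℝ) : Prop :=
  x = G α R v x

/-- A vector is stochastic if it is entrywise nonnegative and its entries sum to `1`. -/
def IsStochastic {n : ℕ} (x : Fin n → ℝ) : Prop := 0 ≤ x ∧ 1 ⬝ᵥ x = 1

/-- `m` is the minimal nonnegative solution: a nonnegative solution which is entrywise at most
every other nonnegative solution. -/
def IsMinimalNonnegSolution {n : ℕ} (α : ℝ) (R : Matrix (Fin n) (Fin n × Fin n) ℝ)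
    (v : Fin n → ℝ) (m : Fin n → ℝ) : Prop :=
  IsLeast {x : Fin n → ℝ | 0 ≤ x ∧ IsSolution α R v x} m

end MultilinearPageRank

/-! ### Scarf's lemma by a parity argument. -/

namespace Scarf

/-! Since the columns of `R` sum to one, the mass `t` of `x` becomes `α t² + (1 - α)` under `G`. The
fixed points of this quadratic are `1` and `(1 - α) / α`, so they are the only masses a solution can
have. On nonnegative vectors `G` is monotone, so its iterates from `0` increase, stay below every
nonnegative solution, and have mass at most either root; their limit is the minimal solution `m`,
whose mass is the smaller root. If `α ≤ 1/2` that root is `1`, and a stochastic solution above `m`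
with equal mass equals `m`. If `α > 1/2`, then `G` maps the simplex of vectors of mass `1` above `m`
to itself, and Brouwer's theorem gives `s`.

Brouwer's theorem is derived from Scarf's lemma (`exists_dominant_rainbow`), applied to ever finer
grids in the simplex. -/

/-- A finite set `σ` is dominant for the family of orders given by the keys `k i` if no element
lies strictly above the minimum of `σ` in all of the orders. -/
def Dominant {T I L : Type*} [LinearOrder L] (k : I → T → L) (σ : Finset T) : Prop :=
  ∀ t, ∃ i, ∀ s ∈ σ, k i t ≤ k i s

theorem Dominant.mono {T I L : Type*} [LinearOrder L] {k : I → T → L} {σ τ : Finset T} (h : Dominant k σ) (hτ : τ ⊆ σ) : Dominant k τ := by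
  intro t
  obtain ⟨i, hi⟩ := h t
  exact ⟨i, fun s hs => hi s (hτ hs)⟩

/-- A dominant set with one element less than there are orders, which contains an element that is
not a slack element, extends by one element to a dominant set in exactly two ways. -/
theorem card_dominant_insert_eq_two {T I L : Type*} [Fintype T] [DecidableEq T] [Fintype I]
    [LinearOrder L] {k : I → T → L} (hk : ∀ i, Function.Injective (k i)) (e : I → T)
    (he : Function.Injective e) (hbot : ∀ j t, k j (e j) ≤ k j t)
    (htop : ∀ i j t, i ≠ j → t ∉ Set.range e → k i t < k i (e j))
    {τ : Finset T} (hτ : Dominant k τ) (hcard : τ.card + 1 = Fintype.card I)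
    {z : T} (hz : z ∈ τ) (hze : z ∉ Set.range e) :
    ∃ x₁ x₂, x₁ ≠ x₂ ∧ ∀ x, (x ∉ τ ∧ Dominant k (insert x τ)) ↔ x = x₁ ∨ x = x₂ := by
  classical
  -- `f i` is the minimum of `τ` in order `i`. Dominance makes `f` onto `τ`, which has one element
  -- fewer than `I`, so a single value is repeated, at `i₁` and `i₂`.
  have hmin : ∀ i, ∃ s ∈ τ, ∀ t ∈ τ, k i s ≤ k i t := fun i =>
    Finset.exists_min_image τ (k i) ⟨z, hz⟩
  choose f hfτ hf using hmin
  have hfe : ∀ i, f i = e i ∨ f i ∉ Set.range e := by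
    intro i
    by_contra! h
    obtain ⟨h1, j, hj⟩ := h
    have hij : i ≠ j := fun hij => h1 (by rw [← hj, hij])
    have := htop i j z hij hze
    rw [hj] at this
    exact absurd (hf i z hz) (not_le.2 this)
  have hsurj : ∀ s ∈ τ, ∃ i, f i = s := by
    intro s hs
    obtain ⟨i, hi⟩ := hτ s
    exact ⟨i, hk i (le_antisymm (hf i s hs) (hi _ (hfτ i)))⟩
  have huniv : Finset.univ.image f = τ := by
    ext s
    simp only [Finset.mem_image, Finset.mem_univ, true_and]
    exact ⟨fun ⟨i, hi⟩ => hi ▸ hfτ i, hsurj s⟩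
  obtain ⟨i₁, i₂, hf12, h12⟩ : ∃ i₁ i₂, f i₁ = f i₂ ∧ i₁ ≠ i₂ := by
    have : ¬ Function.Injective f := fun hinj => by
      have := Finset.card_image_of_injective Finset.univ hinj
      rw [huniv, Finset.card_univ] at this
      omega
    simpa [Function.Injective] using this
  -- the restriction of `f` to the complement of `i₁` or `i₂` is onto
  have honto : ∀ l, (l = i₁ ∨ l = i₂) → ∀ s ∈ τ, ∃ i, i ≠ l ∧ f i = s := by
    intro l hl s hs
    obtain ⟨i, hi⟩ := hsurj s hs
    by_cases hil : i = l
    · rcases hl with rfl | rfl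
      · exact ⟨i₂, h12.symm, by rw [← hf12, ← hil, hi]⟩
      · exact ⟨i₁, h12, by rw [hf12, ← hil, hi]⟩
    · exact ⟨i, hil, hi⟩
  -- A new element must take over as minimum in order `i₁` or `i₂` and stay above the old minima in
  -- all other orders. Dominance forces it to be the highest such candidate, `X l`.
  let M : I → Finset T := fun l => Finset.univ.filter fun t => ∀ i, i ≠ l → k i (f i) < k i t
  have hM : ∀ l t, t ∈ M l ↔ ∀ i, i ≠ l → k i (f i) < k i t := by simp [M]
  have hMne : ∀ l, (M l).Nonempty := by
    intro l
    refine ⟨e l, (hM _ _).2 fun i hi => ?_⟩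
    rcases hfe i with h | h
    · rw [h]
      exact lt_of_le_of_ne (hbot _ _) fun h' => hi (he (hk i h'))
    · exact htop i l _ hi h
  have hmax : ∀ l, ∃ x ∈ M l, ∀ t ∈ M l, k l t ≤ k l x := fun l =>
    Finset.exists_max_image (M l) (k l) (hMne l)
  choose X hXM hX using hmax
  have hgood : ∀ l, (l = i₁ ∨ l = i₂) → X l ∉ τ ∧ Dominant k (insert (X l) τ) := by
    intro l hl
    refine ⟨fun hmem => ?_, fun t => ?_⟩
    · obtain ⟨i, hi, hs⟩ := honto l hl _ hmem
      have := (hM _ _).1 (hXM l) i hi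
      rw [hs] at this
      exact lt_irrefl _ this
    · by_cases h : ∃ i, i ≠ l ∧ k i t ≤ k i (f i)
      · obtain ⟨i, hi, hti⟩ := h
        refine ⟨i, fun s hs => ?_⟩
        rcases Finset.mem_insert.1 hs with rfl | hs
        · exact hti.trans ((hM _ _).1 (hXM l) i hi).le
        · exact hti.trans (hf i s hs)
      · push Not at h
        obtain ⟨i, hi⟩ := hτ t
        have hil : i = l := by
          by_contra hil
          exact absurd (hi _ (hfτ i)) (not_le.2 (h i hil))
        subst hil
        refine ⟨i, fun s hs => ?_⟩
        rcases Finset.mem_insert.1 hs with rfl | hs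
        · exact hX i t ((hM _ _).2 h)
        · exact hi s hs
  refine ⟨X i₁, X i₂, fun hX12 => ?_, fun x => ⟨fun ⟨hxτ, hdom⟩ => ?_, ?_⟩⟩
  · obtain ⟨i, hi⟩ := hτ (X i₁)
    refine absurd (hi _ (hfτ i)) (not_le.2 ?_)
    by_cases h : i = i₁
    · rw [hX12]
      exact (hM _ _).1 (hXM i₂) i (by rw [h]; exact h12)
    · exact (hM _ _).1 (hXM i₁) i h
  -- By counting, `g` is a bijection from `insert x τ` to the orders, sending each element to an
  -- order in which it is the minimum.
  · choose g hg using hdom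
    have hginj : Set.InjOn g (insert x τ : Finset T) := by
      intro s hs t ht hst
      exact hk (g s) (le_antisymm (hg s t ht) (by rw [hst]; exact hg t s hs))
    have hgimg : (insert x τ).image g = Finset.univ := by
      apply Finset.eq_univ_of_card
      rw [Finset.card_image_of_injOn hginj, Finset.card_insert_of_notMem hxτ, hcard]
    have hxs : x ∈ insert x τ := Finset.mem_insert_self _ _
    have hother : ∀ i, i ≠ g x → ∃ s ∈ τ, g s = i ∧ f i = s := by
      intro i hi
      have : i ∈ (insert x τ).image g := by rw [hgimg]; exact Finset.mem_univ _
      obtain ⟨s, hs, hsi⟩ := Finset.mem_image.1 this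
      rcases Finset.mem_insert.1 hs with rfl | hs'
      · exact absurd hsi.symm hi
      · refine ⟨s, hs', hsi, hk i (le_antisymm (hf i s hs') ?_)⟩
        rw [← hsi]
        exact hg s _ (Finset.mem_insert_of_mem (hfτ _))
    have hxM : x ∈ M (g x) := by
      refine (hM _ _).2 fun i hi => ?_
      obtain ⟨s, hs, hsi, hfs⟩ := hother i hi
      refine lt_of_le_of_ne ?_ fun h => hxτ ((hk i h) ▸ hfτ i)
      rw [hfs, ← hsi]
      exact hg s x hxs
    have hgx : g x = i₁ ∨ g x = i₂ := by
      by_contra! h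
      obtain ⟨s, _, hs1, hs2⟩ := hother i₁ (Ne.symm h.1)
      obtain ⟨t, _, ht1, ht2⟩ := hother i₂ (Ne.symm h.2)
      have : s = t := by rw [← hs2, ← ht2, hf12]
      exact h12 (by rw [← hs1, ← ht1, this])
    have hxX : x = X (g x) := by
      refine hk (g x) (le_antisymm (hX _ x hxM) ?_)
      have h1 : g (X (g x)) = g x := by
        by_contra h
        have h2 := (hM _ _).1 (hXM (g x)) _ h
        exact absurd (hg (X (g x)) _ (Finset.mem_insert_of_mem (hfτ _))) (not_le.2 h2)
      have := hg (X (g x)) x hxs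
      rwa [h1] at this
    rcases hgx with h | h
    · left; rw [hxX, h]
    · right; rw [hxX, h]
  · rintro (rfl | rfl)
    · exact hgood _ (Or.inl rfl)
    · exact hgood _ (Or.inr rfl)

/-- The facets of a set `σ` that carry all labels but `i₀` come in pairs, unless `σ` carries all
labels. -/
theorem even_card_facets {T I : Type*} [DecidableEq T] [Fintype I] [DecidableEq I]
    (c : T → I) (i₀ : I) {σ : Finset T} (hσ : σ.card = Fintype.card I)
    (hc : σ.image c ≠ Finset.univ) :
    Even (σ.powerset.filter fun τ => τ.card + 1 = Fintype.card I ∧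
      τ.image c = Finset.univ.erase i₀).card := by
  classical
  rcases Finset.eq_empty_or_nonempty (σ.powerset.filter fun τ => τ.card + 1 = Fintype.card I ∧
      τ.image c = Finset.univ.erase i₀) with h | ⟨τ, hτ⟩
  · simp [h]
  obtain ⟨hτσ, hτc, himg⟩ : τ ⊆ σ ∧ τ.card + 1 = Fintype.card I ∧
      τ.image c = Finset.univ.erase i₀ := by simpa using hτ
  obtain ⟨x, hxτ, rfl⟩ : ∃ x, x ∉ τ ∧ insert x τ = σ :=
    Finset.covBy_iff_exists_insert.1 ((Finset.covBy_iff_card_sdiff_eq_one).2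
      ⟨hτσ, by rw [Finset.card_sdiff_of_subset hτσ]; omega⟩)
  have hmem : ∀ i, i ∈ τ.image c ↔ i ≠ i₀ := by simp [himg]
  have hinj : Set.InjOn c τ := by
    rw [← Finset.card_image_iff, himg, Finset.card_erase_of_mem (Finset.mem_univ _),
      Finset.card_univ]
    omega
  have hcx : c x ≠ i₀ := by
    intro h
    apply hc
    rw [Finset.image_insert, himg, h, Finset.insert_erase (Finset.mem_univ _)]
  -- The label of `x` is repeated at `y` only, so the facets sought are those omitting `x` or `y`.
  obtain ⟨y, hyτ, hyx⟩ := Finset.mem_image.1 ((hmem _).2 hcx)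
  have hxy : x ≠ y := fun h => hxτ (h ▸ hyτ)
  have hall : ∀ w ∈ insert x τ, ((insert x τ).erase w).card + 1 = Fintype.card I := by
    intro w hw
    rw [Finset.card_erase_add_one hw, hσ]
  suffices hs : (insert x τ).powerset.filter (fun τ => τ.card + 1 = Fintype.card I ∧
      τ.image c = Finset.univ.erase i₀) = {(insert x τ).erase x, (insert x τ).erase y} by
    rw [hs, Finset.card_pair]
    · exact even_two
    · intro h
      have : x ∈ (insert x τ).erase y := by simp [hxy]
      rw [← h] at this
      simp at this
  have hyimg : ((insert x τ).erase y).image c = τ.image c := by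
    ext i
    simp only [Finset.mem_image, Finset.mem_erase, Finset.mem_insert]
    constructor
    · rintro ⟨s, ⟨h1, rfl | h2⟩, rfl⟩
      · exact ⟨y, hyτ, hyx⟩
      · exact ⟨s, h2, rfl⟩
    · rintro ⟨s, hs, rfl⟩
      by_cases h : s = y
      · exact ⟨x, ⟨hxy, Or.inl rfl⟩, by rw [h, hyx]⟩
      · exact ⟨s, ⟨h, Or.inr hs⟩, rfl⟩
  ext ρ
  simp only [Finset.mem_filter, Finset.mem_powerset, Finset.mem_insert, Finset.mem_singleton]
  constructor
  · rintro ⟨hρ, hρc, hρi⟩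
    have hρinj : Set.InjOn c ρ := by
      rw [← Finset.card_image_iff, hρi, Finset.card_erase_of_mem (Finset.mem_univ _),
        Finset.card_univ]
      omega
    have key : ∀ w ∈ insert x τ, w ∉ ρ → ρ = (insert x τ).erase w := by
      intro w hw hwρ
      refine Finset.eq_of_subset_of_card_le (Finset.subset_erase.2 ⟨hρ, hwρ⟩) ?_
      have := hall w hw
      omega
    by_cases hx : x ∈ ρ
    · right
      exact key y (by simp [hyτ]) fun hy => hxy (hρinj hx hy hyx.symm)
    · left
      exact key x (by simp) hx
  · rintro (rfl | rfl)
    · refine ⟨Finset.erase_subset _ _, hall _ (by simp), ?_⟩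
      rw [Finset.erase_insert hxτ, himg]
    · exact ⟨Finset.erase_subset _ _, hall _ (by simp [hyτ]), by rw [hyimg, himg]⟩

/-- **Scarf's lemma** for linear orders: a labelling of a finite set that gives the slack element
`e j` the label `j` admits a dominant set on which every label occurs exactly once. -/
theorem exists_dominant_rainbow {T I L : Type*} [Fintype T] [DecidableEq T] [Fintype I]
    [DecidableEq I] [LinearOrder L] {k : I → T → L} (hk : ∀ i, Function.Injective (k i)) (e : I → T)
    (he : Function.Injective e) (hbot : ∀ j t, k j (e j) ≤ k j t)
    (htop : ∀ i j t, i ≠ j → t ∉ Set.range e → k i t < k i (e j))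
    (c : T → I) (hce : ∀ j, c (e j) = j) (i₀ : I) (t₀ : T) (ht₀ : t₀ ∉ Set.range e) :
    ∃ σ : Finset T, Dominant k σ ∧ σ.card = Fintype.card I ∧ σ.image c = Finset.univ := by
  classical
  by_contra! hno
  -- Incidences between `D` and `R` are counted modulo 2. Without a rainbow set each `σ ∈ R`
  -- contributes evenly, whereas in `D` only `τ₀`, made of slack elements, contributes an odd
  -- number.
  let D : Finset (Finset T) := Finset.univ.filter fun τ => Dominant k τ ∧
    (τ.card + 1 = Fintype.card I ∧ τ.image c = Finset.univ.erase i₀)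
  let R : Finset (Finset T) := Finset.univ.filter fun σ => Dominant k σ ∧
    σ.card = Fintype.card I
  have hcount := Finset.sum_card_bipartiteAbove_eq_sum_card_bipartiteBelow
    (s := D) (t := R) (fun τ σ : Finset T => τ ⊆ σ)
  have heven : Even (∑ σ ∈ R, (D.bipartiteBelow (fun τ σ : Finset T => τ ⊆ σ) σ).card) := by
    refine Finset.even_sum _ fun σ hσ => ?_
    obtain ⟨hσd, hσc⟩ := (Finset.mem_filter.1 hσ).2
    refine (congrArg (fun s => Even (Finset.card s)) ?_).mpr
      (even_card_facets c i₀ hσc (hno σ hσd hσc))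
    ext τ
    simp only [Finset.bipartiteBelow, D, Finset.mem_filter, Finset.mem_univ, true_and,
      Finset.mem_powerset]
    exact ⟨fun h => ⟨h.2, h.1.2⟩, fun h => ⟨⟨hσd.mono h.1, h.2⟩, h.1⟩⟩
  have habove : ∀ τ ∈ D, (R.bipartiteAbove (fun τ σ : Finset T => τ ⊆ σ) τ).card =
      (Finset.univ.filter fun x => x ∉ τ ∧ Dominant k (insert x τ)).card := by
    intro τ hτ
    obtain ⟨_, hτc, _⟩ := (Finset.mem_filter.1 hτ).2
    symm
    refine Finset.card_bij (fun x _ => insert x τ) ?_ ?_ ?_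
    · intro x hx
      obtain ⟨hx1, hx2⟩ := (Finset.mem_filter.1 hx).2
      simp only [Finset.bipartiteAbove, R, Finset.mem_filter, Finset.mem_univ, true_and]
      exact ⟨⟨hx2, by rw [Finset.card_insert_of_notMem hx1, hτc]⟩, Finset.subset_insert _ _⟩
    · intro x hx y hy hxy
      have hx1 := (Finset.mem_filter.1 hx).2.1
      have : x ∈ insert y τ := hxy ▸ Finset.mem_insert_self x τ
      rcases Finset.mem_insert.1 this with h | h
      · exact h
      · exact absurd h hx1
    · intro σ hσ
      simp only [Finset.bipartiteAbove, R, Finset.mem_filter, Finset.mem_univ, true_and] at hσ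
      obtain ⟨⟨hσd, hσc⟩, hτσ⟩ := hσ
      obtain ⟨x, hxτ, rfl⟩ : ∃ x, x ∉ τ ∧ insert x τ = σ :=
        Finset.covBy_iff_exists_insert.1 ((Finset.covBy_iff_card_sdiff_eq_one).2
          ⟨hτσ, by rw [Finset.card_sdiff_of_subset hτσ]; omega⟩)
      exact ⟨x, by simp [hxτ, hσd], rfl⟩
  let τ₀ : Finset T := (Finset.univ.erase i₀).image e
  have hτ₀mem : ∀ s, s ∈ τ₀ ↔ ∃ j, j ≠ i₀ ∧ e j = s := by simp [τ₀]
  have hτ₀D : τ₀ ∈ D := by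
    refine Finset.mem_filter.2 ⟨Finset.mem_univ _, fun t => ?_, ?_, ?_⟩
    · by_cases ht : t ∈ Set.range e
      · obtain ⟨l, rfl⟩ := ht
        exact ⟨l, fun s _ => hbot l s⟩
      · refine ⟨i₀, fun s hs => ?_⟩
        obtain ⟨j, hj, rfl⟩ := (hτ₀mem s).1 hs
        exact (htop i₀ j t hj.symm ht).le
    · rw [Finset.card_image_of_injective _ he, Finset.card_erase_add_one (Finset.mem_univ _),
        Finset.card_univ]
    · rw [Finset.image_image, show c ∘ e = id from funext hce, Finset.image_id]
  have hone : (Finset.univ.filter fun x => x ∉ τ₀ ∧ Dominant k (insert x τ₀)).card = 1 := by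
    -- Only the non-slack element highest in order `i₀` extends `τ₀` to a dominant set.
    obtain ⟨w, hw, hwmax⟩ := Finset.exists_max_image
      (Finset.univ.filter fun t => t ∉ Set.range e) (k i₀) ⟨t₀, by simpa using ht₀⟩
    have hwe : w ∉ Set.range e := (Finset.mem_filter.1 hw).2
    rw [Finset.card_eq_one]
    refine ⟨w, ?_⟩
    ext x
    simp only [Finset.mem_filter, Finset.mem_univ, true_and, Finset.mem_singleton]
    have hidx : ∀ t, t ∉ Set.range e → ∀ i, (∀ s ∈ insert x τ₀, k i t ≤ k i s) → i = i₀ := by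
      intro t ht i hi
      by_contra h
      have h1 := hi (e i) (Finset.mem_insert_of_mem ((hτ₀mem _).2 ⟨i, h, rfl⟩))
      exact ht ⟨i, hk i (le_antisymm (hbot i t) h1)⟩
    constructor
    · rintro ⟨hx, hd⟩
      have hle : ∀ t, t ∉ Set.range e → k i₀ t ≤ k i₀ x := by
        intro t ht
        obtain ⟨i, hi⟩ := hd t
        have := hidx t ht i hi
        subst this
        exact hi x (Finset.mem_insert_self _ _)
      have hxe : x ∉ Set.range e := by
        rintro ⟨j, rfl⟩
        have hj : j = i₀ := by
          by_contra h
          exact hx ((hτ₀mem _).2 ⟨j, h, rfl⟩)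
        subst hj
        exact ht₀ ⟨j, hk j (le_antisymm (hbot j t₀) (hle t₀ ht₀))⟩
      exact hk i₀ (le_antisymm (hwmax x (by simpa using hxe)) (hle w hwe))
    · rintro rfl
      refine ⟨fun h => ?_, fun t => ?_⟩
      · obtain ⟨j, _, hj⟩ := (hτ₀mem _).1 h
        exact hwe ⟨j, hj⟩
      · by_cases ht : t ∈ Set.range e
        · obtain ⟨l, rfl⟩ := ht
          exact ⟨l, fun s _ => hbot l s⟩
        · refine ⟨i₀, fun s hs => ?_⟩
          rcases Finset.mem_insert.1 hs with rfl | hs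
          · exact hwmax t (by simpa using ht)
          · obtain ⟨j, hj, rfl⟩ := (hτ₀mem s).1 hs
            exact (htop i₀ j t hj.symm ht).le
  have htwo : ∀ τ ∈ D.erase τ₀,
      Even (R.bipartiteAbove (fun τ σ : Finset T => τ ⊆ σ) τ).card := by
    intro τ hτ
    obtain ⟨hne, hτD⟩ := Finset.mem_erase.1 hτ
    obtain ⟨hd, hτc, himg⟩ := (Finset.mem_filter.1 hτD).2
    obtain ⟨z, hz, hze⟩ : ∃ z ∈ τ, z ∉ Set.range e := by
      by_contra! h
      refine hne (Finset.eq_of_subset_of_card_le (fun s hs => ?_) ?_)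
      · obtain ⟨j, rfl⟩ := h s hs
        refine (hτ₀mem _).2 ⟨j, ?_, rfl⟩
        have := Finset.mem_image_of_mem c hs
        rw [himg, hce] at this
        exact (Finset.mem_erase.1 this).1
      · have := (Finset.mem_filter.1 hτ₀D).2.2.1
        omega
    obtain ⟨x₁, x₂, h12, hx⟩ := card_dominant_insert_eq_two hk e he hbot htop hd hτc hz hze
    rw [habove τ hτD, show (Finset.univ.filter fun x => x ∉ τ ∧ Dominant k (insert x τ)) =
      {x₁, x₂} by ext x; simpa using hx x, Finset.card_pair h12]
    exact even_two
  rw [← hcount, ← Finset.add_sum_erase D _ hτ₀D, habove τ₀ hτ₀D, hone] at heven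
  have := Finset.even_sum _ htwo
  rw [Nat.even_add] at heven
  exact absurd (heven.2 this) (by decide)

end Scarf

/-! ### From Scarf's lemma to Brouwer's theorem. -/

namespace Scarf

open Filter Topology

/-- The keys used to order the grid points and the slack elements: the `i`-th key is the `i`-th
coordinate on grid points, is minimal at the `i`-th slack element and large at the other slack
elements; ties are broken by an enumeration of the elements. -/
def gridKey {I P : Type*} [DecidableEq I] (N : ℕ) (val : P → I → ℕ) (rank : P ⊕ I → ℕ) (i : I) :
    P ⊕ I → ℕ ×ₗ ℕ
  -- The shift by `1` puts grid points above `(0, 0)`; coordinates are at most `N`, so `N + 2`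
  -- exceeds every shifted one.
  | Sum.inl p => toLex (val p i + 1, rank (Sum.inl p))
  | Sum.inr j => if i = j then toLex (0, 0) else toLex (N + 2, rank (Sum.inr j))

/-- A labelling of the grid points of the `N`-fold simplex: some grid point has, for every `i`, a
nearby grid point that is labelled `i` or whose `i`-th coordinate is small. -/
theorem exists_grid_point {I : Type*} [Fintype I] [DecidableEq I] [Nonempty I] (N : ℕ)
    (c : (I → ℕ) → I) :
    ∃ a : I → ℕ, ∑ j, a j = N ∧ ∀ i, ∃ b : I → ℕ, ∑ j, b j = N ∧
      (∀ j, a j ≤ b j + Fintype.card I ∧ b j ≤ a j + Fintype.card I) ∧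
      (c b = i ∨ b i ≤ Fintype.card I) := by
  classical
  let P := {a : I → ℕ // a ∈ Finset.piAntidiag Finset.univ N}
  have : Fintype P := Finset.Subtype.fintype _
  have hP : ∀ a : P, ∑ j, a.1 j = N := fun a => (Finset.mem_piAntidiag.1 a.2).1
  let rank : P ⊕ I → ℕ := fun s => Fintype.equivFin (P ⊕ I) s
  have hrank : Function.Injective rank :=
    Fin.val_injective.comp (Fintype.equivFin (P ⊕ I)).injective
  let k : I → P ⊕ I → ℕ ×ₗ ℕ := gridKey N Subtype.val rank
  have hkl : ∀ i p, k i (Sum.inl p) = toLex (p.1 i + 1, rank (Sum.inl p)) := fun _ _ => rfl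
  have hkr : ∀ i j, k i (Sum.inr j) =
    if i = j then toLex (0, 0) else toLex (N + 2, rank (Sum.inr j)) := fun _ _ => rfl
  have hcoord : ∀ (p : P) i, p.1 i ≤ N := fun p i =>
    (Finset.single_le_sum (f := p.1) (fun _ _ => Nat.zero_le _) (Finset.mem_univ i)).trans_eq
      (hP p)
  have hk : ∀ i, Function.Injective (k i) := by
    rintro i (p | j) (q | l) h
    · rw [hkl, hkl] at h
      exact hrank (Prod.ext_iff.1 (toLex.injective h)).2
    · rw [hkl, hkr] at h
      have := hcoord p i
      split_ifs at h
      · have := (Prod.ext_iff.1 (toLex.injective h)).1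
        simp at this
      · have := (Prod.ext_iff.1 (toLex.injective h)).1
        simp at this
        omega
    · rw [hkl, hkr] at h
      have := hcoord q i
      split_ifs at h
      · have := (Prod.ext_iff.1 (toLex.injective h)).1
        simp at this
      · have := (Prod.ext_iff.1 (toLex.injective h)).1
        simp at this
        omega
    · rw [hkr, hkr] at h
      split_ifs at h with h1 h2 h2
      · rw [← h1, ← h2]
      · have := (Prod.ext_iff.1 (toLex.injective h)).1
        simp at this
      · have := (Prod.ext_iff.1 (toLex.injective h)).1
        simp at this
      · exact hrank (Prod.ext_iff.1 (toLex.injective h)).2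
  have hbot : ∀ j t, k j (Sum.inr j) ≤ k j t := by
    intro j t
    rw [hkr, if_pos rfl]
    exact bot_le (α := ℕ ×ₗ ℕ)
  have htop : ∀ i j t, i ≠ j → t ∉ Set.range (Sum.inr : I → P ⊕ I) →
      k i t < k i (Sum.inr j) := by
    rintro i j (p | l) hij ht
    · rw [hkr, if_neg hij, hkl, Prod.Lex.toLex_lt_toLex]
      have := hcoord p i
      left
      simp only
      omega
    · exact absurd ⟨l, rfl⟩ ht
  let i₀ : I := Classical.arbitrary I
  let p₀ : P := ⟨fun i => if i = i₀ then N else 0, by simp [Finset.mem_piAntidiag]⟩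
  obtain ⟨σ, hσ, hσc, hσi⟩ := exists_dominant_rainbow hk Sum.inr Sum.inr_injective hbot htop
    (Sum.elim (fun p : P => c p.1) id) (fun _ => rfl) i₀ (Sum.inl p₀) (by simp)
  -- the labels that come from grid points
  let C : Finset I := Finset.univ.filter fun i => Sum.inr i ∉ σ
  let Q : Finset P := Finset.univ.filter fun p => Sum.inl p ∈ σ
  have hC : ∀ i ∈ C, ∃ p ∈ Q, c p.1 = i := by
    intro i hi
    have : i ∈ σ.image (Sum.elim (fun p : P => c p.1) id) := by
      rw [hσi]; exact Finset.mem_univ _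
    obtain ⟨p | j, hp, hpi⟩ := Finset.mem_image.1 this
    · exact ⟨p, by simp [Q, hp], hpi⟩
    · simp only [Sum.elim_inr, id] at hpi
      subst hpi
      exact absurd hp (by simpa [C] using hi)
  -- If slack `i` lies in `σ`, it is the bottom of order `i`, so a grid point can only be dominated
  -- in an order from `C`.
  have hdom : ∀ p : P, ∃ i ∈ C, ∀ q ∈ Q, p.1 i ≤ q.1 i := by
    intro p
    obtain ⟨i, hi⟩ := hσ (Sum.inl p)
    refine ⟨i, ?_, fun q hq => ?_⟩
    · simp only [C, Finset.mem_filter, Finset.mem_univ, true_and]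
      intro h
      have := hi _ h
      rw [hkl, hkr, if_pos rfl, Prod.Lex.toLex_le_toLex] at this
      simp at this
    · have := hi _ (by simpa [Q] using hq)
      rw [hkl, hkl, Prod.Lex.toLex_le_toLex] at this
      simp only at this
      omega
  obtain ⟨i₁, hi₁, _⟩ := hdom p₀
  have hQ : Q.Nonempty := by
    obtain ⟨p, hp, _⟩ := hC i₁ hi₁
    exact ⟨p, hp⟩
  let m : I → ℕ := fun i => if i ∈ C then Q.inf' hQ fun q => q.1 i else 0
  have hmle : ∀ q ∈ Q, ∀ i, m i ≤ q.1 i := by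
    intro q hq i
    simp only [m]
    split_ifs
    · exact Finset.inf'_le _ hq
    · exact Nat.zero_le _
  have hsum : N < ∑ i, m i + Fintype.card I := by
    by_contra! hle
    have hcard : ∑ i, (if i ∈ C then m i + 1 else 0) ≤ N := by
      refine le_trans ?_ hle
      rw [← Finset.card_univ, Finset.card_eq_sum_ones, ← Finset.sum_add_distrib]
      refine Finset.sum_le_sum fun i _ => ?_
      split_ifs <;> omega
    -- This grid point exceeds the minima of `Q` in every coordinate of `C`, the leftover mass being
    -- put on `i₁ ∈ C`; that contradicts `hdom`.
    let t : I → ℕ := fun i => (if i ∈ C then m i + 1 else 0) +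
      if i = i₁ then N - ∑ i, (if i ∈ C then m i + 1 else 0) else 0
    have ht : t ∈ Finset.piAntidiag Finset.univ N := by
      rw [Finset.mem_piAntidiag]
      refine ⟨?_, fun _ _ => Finset.mem_univ _⟩
      simp only [t, Finset.sum_add_distrib, Finset.sum_ite_eq', Finset.mem_univ, if_true]
      omega
    obtain ⟨i, hi, hq⟩ := hdom ⟨t, ht⟩
    have h1 : t i ≤ Q.inf' hQ fun q => q.1 i := Finset.le_inf' _ _ fun q hq' => hq q hq'
    simp only [t, m, if_pos hi] at h1
    omega
  -- The differences `q - m` are nonnegative and sum to less than `Fintype.card I`.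
  have hclose : ∀ q ∈ Q, ∀ i, q.1 i ≤ m i + Fintype.card I := by
    intro q hq i
    have h1 : q.1 i - m i ≤ ∑ j, (q.1 j - m j) :=
      Finset.single_le_sum (f := fun j => q.1 j - m j) (fun _ _ => Nat.zero_le _)
        (Finset.mem_univ i)
    rw [Finset.sum_tsub_distrib _ fun j _ => hmle q hq j, hP q] at h1
    omega
  obtain ⟨a, ha⟩ := hQ
  refine ⟨a.1, hP a, fun i => ?_⟩
  by_cases hi : i ∈ C
  · obtain ⟨b, hb, hbi⟩ := hC i hi
    refine ⟨b.1, hP b, fun j => ⟨?_, ?_⟩, Or.inl hbi⟩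
    · have := hclose a ha j; have := hmle b hb j; omega
    · have := hclose b hb j; have := hmle a ha j; omega
  · refine ⟨a.1, hP a, fun j => by omega, Or.inr ?_⟩
    have := hclose a ha i
    simpa only [m, if_neg hi, zero_add] using this

/-- **Brouwer's fixed point theorem** for the standard simplex. -/
theorem exists_fixedPoint_stdSimplex {I : Type*} [Fintype I] [Nonempty I]
    {f : (I → ℝ) → I → ℝ} (hf : ContinuousOn f (stdSimplex ℝ I))
    (hmaps : Set.MapsTo f (stdSimplex ℝ I) (stdSimplex ℝ I)) :
    ∃ x ∈ stdSimplex ℝ I, f x = x := by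
  classical
  let pt : ℕ → (I → ℕ) → I → ℝ := fun N a i => (a i : ℝ) / (N + 1 : ℝ)
  have hpt : ∀ N (a : I → ℕ), ∑ j, a j = N + 1 → pt N a ∈ stdSimplex ℝ I := by
    intro N a ha
    refine ⟨fun i => by positivity, ?_⟩
    simp only [pt]
    rw [← Finset.sum_div, ← Nat.cast_sum, ha]
    push_cast
    exact div_self (by positivity)
  -- A point and its image have equal mass, so some coordinate does not decrease; it serves as the
  -- label.
  have hlabel : ∀ N (a : I → ℕ), ∃ i, ∑ j, a j = N + 1 → pt N a i ≤ f (pt N a) i := by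
    intro N a
    by_cases ha : ∑ j, a j = N + 1
    · have h1 := hpt N a ha
      have h2 := hmaps h1
      obtain ⟨i, _, hi⟩ := Finset.exists_le_of_sum_le (s := Finset.univ) Finset.univ_nonempty
        (f := pt N a) (g := f (pt N a)) (by rw [h1.2, h2.2])
      exact ⟨i, fun _ => hi⟩
    · exact ⟨Classical.arbitrary I, fun h => absurd h ha⟩
  choose c hc using hlabel
  have hgrid := fun N => exists_grid_point (N + 1) (c N)
  choose a ha b hb hab hbc using hgrid
  obtain ⟨x, hx, φ, hφ, hlim⟩ := (isCompact_stdSimplex (𝕜 := ℝ) I).tendsto_subseq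
    fun N => hpt N (a N) (ha N)
  let ε : ℕ → ℝ := fun N => (Fintype.card I : ℝ) / (N + 1 : ℝ)
  have hε0 : Tendsto ε atTop (𝓝 0) := by
    simpa [ε, div_eq_mul_inv] using
      (tendsto_one_div_add_atTop_nhds_zero_nat (𝕜 := ℝ)).const_mul (Fintype.card I : ℝ)
  have hε : Tendsto (fun N => ε (φ N)) atTop (𝓝 0) := hε0.comp hφ.tendsto_atTop
  -- For each `i`, nearby points that are labelled `i` or have small `i`-th coordinate converge to
  -- `x`. Either way the inequality holds up to `ε`. Equal masses then force equality.
  have hle : ∀ i, x i ≤ f x i := by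
    intro i
    have hdist : ∀ N j, |pt N (b N i) j - pt N (a N) j| ≤ ε N := by
      intro N j
      simp only [pt, ε]
      have h1 : ((a N j : ℕ) : ℝ) ≤ b N i j + Fintype.card I := by exact_mod_cast (hab N i j).1
      have h2 : ((b N i j : ℕ) : ℝ) ≤ a N j + Fintype.card I := by exact_mod_cast (hab N i j).2
      rw [← sub_div, abs_div, abs_of_pos (by positivity : (0 : ℝ) < N + 1)]
      gcongr
      rw [abs_le]
      constructor <;> linarith
    have hblim : Tendsto (fun N => pt (φ N) (b (φ N) i)) atTop (𝓝 x) := by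
      rw [tendsto_pi_nhds]
      intro j
      have h1 : Tendsto (fun N => pt (φ N) (a (φ N)) j) atTop (𝓝 (x j)) :=
        (tendsto_pi_nhds.1 hlim) j
      have h2 : Tendsto (fun N => pt (φ N) (b (φ N) i) j - pt (φ N) (a (φ N)) j) atTop (𝓝 0) :=
        squeeze_zero_norm (fun N => hdist (φ N) j) hε
      simpa using h1.add h2
    have hbmem : ∀ N, pt N (b N i) ∈ stdSimplex ℝ I := fun N => hpt N _ (hb N i)
    have hflim : Tendsto (fun N => f (pt (φ N) (b (φ N) i))) atTop (𝓝 (f x)) :=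
      (hf x hx).tendsto.comp (tendsto_nhdsWithin_iff.2
        ⟨hblim, Eventually.of_forall fun N => hbmem (φ N)⟩)
    have hineq : ∀ N, pt N (b N i) i - ε N ≤ f (pt N (b N i)) i := by
      intro N
      have hε0 : 0 ≤ ε N := by positivity
      rcases hbc N i with h | h
      · have := hc N (b N i) (hb N i)
        rw [h] at this
        linarith
      · have h1 : pt N (b N i) i ≤ ε N := by
          simp only [pt, ε]
          gcongr
        have := (hmaps (hbmem N)).1 i
        linarith
    have := le_of_tendsto_of_tendsto' (((tendsto_pi_nhds.1 hblim) i).sub hε)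
      ((tendsto_pi_nhds.1 hflim) i) fun N => hineq (φ N)
    simpa using this
  refine ⟨x, hx, ?_⟩
  have hsum : ∑ i, x i = ∑ i, f x i := by rw [hx.2, (hmaps hx).2]
  funext i
  exact ((Finset.sum_eq_sum_iff_of_le fun i _ => hle i).1 hsum i (Finset.mem_univ i)).symm

end Scarf

/-! ### Monotonicity and mass of the PageRank map. -/

namespace MultilinearPageRank

open Filter Topology

variable {n : ℕ} {α : ℝ} {R : Matrix (Fin n) (Fin n × Fin n) ℝ} {v : Fin n → ℝ}

theorem G_apply (x : Fin n → ℝ) (i : Fin n) :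
    G α R v x i = α * ∑ p, R i p * (x p.1 * x p.2) + (1 - α) * v i := rfl

theorem continuous_G : Continuous (G α R v) := by
  refine continuous_pi fun i => ?_
  simp only [G_apply]
  fun_prop

theorem G_mono (hα : 0 ≤ α) (hR : ∀ i p, 0 ≤ R i p) {x y : Fin n → ℝ} (hx : 0 ≤ x)
    (hxy : x ≤ y) : G α R v x ≤ G α R v y := by
  intro i
  rw [G_apply, G_apply]
  gcongr with p
  · exact hR i p
  · exact hx p.2
  · exact (hx p.1).trans (hxy p.1)
  · exact hxy p.1
  · exact hxy p.2

theorem G_nonneg (hα : α ∈ Set.Ioo (0 : ℝ) 1) (hv : 0 ≤ v) (hR : ∀ i p, 0 ≤ R i p)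
    {x : Fin n → ℝ} (hx : 0 ≤ x) : 0 ≤ G α R v x := by
  intro i
  rw [G_apply]
  have h1 : 0 ≤ ∑ p, R i p * (x p.1 * x p.2) :=
    Finset.sum_nonneg fun p _ => mul_nonneg (hR i p) (mul_nonneg (hx p.1) (hx p.2))
  exact add_nonneg (mul_nonneg hα.1.le h1) (mul_nonneg (sub_nonneg.2 hα.2.le) (hv i))

theorem sum_G (hv : ∑ i, v i = 1) (hR1 : 1 ᵥ* R = 1) (x : Fin n → ℝ) :
    ∑ i, G α R v x i = α * (∑ i, x i) ^ 2 + (1 - α) := by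
  have hcol : ∀ p, ∑ i, R i p = 1 := fun p => by
    have := congrFun hR1 p
    simpa [Matrix.vecMul, dotProduct] using this
  simp only [G_apply]
  rw [Finset.sum_add_distrib, ← Finset.mul_sum, ← Finset.mul_sum, hv, mul_one, Finset.sum_comm]
  congr 2
  simp_rw [← Finset.sum_mul, hcol, one_mul]
  rw [Fintype.sum_prod_type, sq, Finset.sum_mul_sum]

/-- The total mass of a solution is `1` or `(1 - α) / α`. -/
theorem sum_eq_of_isSolution (hα : 0 < α) (hv : ∑ i, v i = 1) (hR1 : 1 ᵥ* R = 1)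
    {x : Fin n → ℝ} (hx : IsSolution α R v x) :
    ∑ i, x i = 1 ∨ ∑ i, x i = (1 - α) / α := by
  have h : ∑ i, x i = α * (∑ i, x i) ^ 2 + (1 - α) := by
    conv_lhs => rw [hx]
    exact sum_G hv hR1 x
  have h2 : (∑ i, x i - 1) * (α * ∑ i, x i - (1 - α)) = 0 := by linear_combination -h
  rcases mul_eq_zero.1 h2 with h | h
  · left; linarith
  · right
    rw [eq_div_iff hα.ne']
    linarith

/-- The fixed point iteration started at zero converges to the minimal nonnegative solution, whose
total mass is at most each of the two possible values. -/
theorem exists_isMinimalNonnegSolution (hα : α ∈ Set.Ioo (0 : ℝ) 1) (hv : IsStochastic v)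
    (hR : ∀ i p, 0 ≤ R i p) (hR1 : 1 ᵥ* R = 1) :
    ∃ m, IsMinimalNonnegSolution α R v m ∧ ∑ i, m i ≤ 1 ∧ ∑ i, m i ≤ (1 - α) / α := by
  have hα0 := hα.1
  have hα1 := hα.2
  have hv1 : ∑ i, v i = 1 := by simpa [dotProduct] using hv.2
  let x : ℕ → Fin n → ℝ := fun k => (G α R v)^[k] 0
  have hsucc : ∀ k, x (k + 1) = G α R v (x k) := fun k => Function.iterate_succ_apply' _ _ _
  have hnonneg : ∀ k, 0 ≤ x k := by
    intro k
    induction k with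
    | zero => exact le_rfl
    | succ k ih => rw [hsucc]; exact G_nonneg hα hv.1 hR ih
  have hmono : Monotone x := by
    refine monotone_nat_of_le_succ fun k => ?_
    induction k with
    | zero => exact hnonneg 1
    | succ k ih => exact (hsucc k).trans_le ((G_mono hα0.le hR (hnonneg k) ih).trans_eq
      (hsucc (k + 1)).symm)
  -- The scalar mass map is increasing on nonnegative reals, so an orbit starting at `0` cannot pass
  -- a fixed point `r`.
  have hbound : ∀ r : ℝ, 0 ≤ r → α * r ^ 2 + (1 - α) = r → ∀ k, ∑ i, x k i ≤ r := by
    intro r hr0 hr k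
    induction k with
    | zero => simpa [x] using hr0
    | succ k ih =>
      rw [hsucc, sum_G hv1 hR1]
      have h0 : 0 ≤ ∑ i, x k i := Finset.sum_nonneg fun i _ => hnonneg k i
      calc α * (∑ i, x k i) ^ 2 + (1 - α) ≤ α * r ^ 2 + (1 - α) := by gcongr
        _ = r := hr
  have h1 := hbound 1 zero_le_one (by ring)
  have h2 := hbound ((1 - α) / α) (div_nonneg (sub_nonneg.2 hα1.le) hα0.le) (by
    field_simp; ring)
  have hcoord : ∀ k i, x k i ≤ 1 := fun k i =>
    (Finset.single_le_sum (f := x k) (fun j _ => hnonneg k j) (Finset.mem_univ i)).trans (h1 k)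
  let m : Fin n → ℝ := fun i => ⨆ k, x k i
  have hlim : Tendsto x atTop (𝓝 m) := tendsto_pi_nhds.2 fun i =>
    tendsto_atTop_ciSup (fun _ _ h => hmono h i) ⟨1, by rintro _ ⟨k, rfl⟩; exact hcoord k i⟩
  have hsumlim : Tendsto (fun k => ∑ i, x k i) atTop (𝓝 (∑ i, m i)) :=
    tendsto_finsetSum _ fun i _ => (tendsto_pi_nhds.1 hlim) i
  refine ⟨m, ⟨⟨ge_of_tendsto' hlim hnonneg, ?_⟩, ?_⟩, le_of_tendsto' hsumlim h1,
    le_of_tendsto' hsumlim h2⟩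
  · refine tendsto_nhds_unique (hlim.comp (tendsto_add_atTop_nat 1)) ?_
    have : Tendsto (fun k => G α R v (x k)) atTop (𝓝 (G α R v m)) :=
      (continuous_G.tendsto m).comp hlim
    exact this.congr fun k => (hsucc k).symm
  · rintro y ⟨hy0, hy⟩
    refine le_of_tendsto' hlim fun k => ?_
    induction k with
    | zero => exact hy0
    | succ k ih =>
      rw [hsucc, show y = G α R v y from hy]
      exact G_mono hα0.le hR (hnonneg k) ih

/-- A nonnegative solution of mass less than `1` lies below a stochastic solution. -/
theorem exists_isStochastic_isSolution_ge (hα : α ∈ Set.Ioo (0 : ℝ) 1) (hv : IsStochastic v)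
    (hR : ∀ i p, 0 ≤ R i p) (hR1 : 1 ᵥ* R = 1) {m : Fin n → ℝ} (hm0 : 0 ≤ m)
    (hm : IsSolution α R v m) (hm1 : ∑ i, m i < 1) :
    ∃ s, IsStochastic s ∧ IsSolution α R v s ∧ m ≤ s := by
  have hv1 : ∑ i, v i = 1 := by simpa [dotProduct] using hv.2
  have : Nonempty (Fin n) := by
    by_contra h
    rw [not_nonempty_iff] at h
    simp at hv1
  set d : ℝ := 1 - ∑ i, m i with hd
  have hd0 : 0 < d := by linarith
  have hsum : ∀ u ∈ stdSimplex ℝ (Fin n), ∑ i, (m + d • u) i = 1 := by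
    intro u hu
    simp only [Pi.add_apply, Pi.smul_apply, smul_eq_mul, Finset.sum_add_distrib,
      ← Finset.mul_sum, hu.2]
    rw [hd]; ring
  have hge : ∀ u ∈ stdSimplex ℝ (Fin n), m ≤ m + d • u := fun u hu =>
    le_add_of_nonneg_right (smul_nonneg hd0.le hu.1)
  -- This is `G` in the coordinates `u ↦ m + d • u`, which identify the simplex with the vectors of
  -- mass `1` above `m`.
  obtain ⟨u, hu, hfu⟩ := Scarf.exists_fixedPoint_stdSimplex
    (f := fun u : Fin n → ℝ => d⁻¹ • (G α R v (m + d • u) - m))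
    (by
      have := continuous_G (α := α) (R := R) (v := v)
      fun_prop)
    (by
      intro u hu
      refine ⟨fun i => ?_, ?_⟩
      · have h1 : m ≤ G α R v (m + d • u) := by
          calc m = G α R v m := hm
            _ ≤ _ := G_mono hα.1.le hR hm0 (hge u hu)
        exact mul_nonneg (inv_nonneg.2 hd0.le) (sub_nonneg.2 (h1 i))
      · simp only [Pi.smul_apply, Pi.sub_apply, smul_eq_mul]
        rw [← Finset.mul_sum, Finset.sum_sub_distrib, sum_G hv1 hR1, hsum u hu]
        rw [show α * 1 ^ 2 + (1 - α) - ∑ i, m i = d by rw [hd]; ring]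
        exact inv_mul_cancel₀ hd0.ne')
  refine ⟨m + d • u, ⟨hm0.trans (hge u hu), ?_⟩, ?_, hge u hu⟩
  · simpa only [dotProduct, Pi.one_apply, one_mul] using hsum u hu
  · have h : d • u = G α R v (m + d • u) - m := by
      conv_lhs => rw [← hfu]
      exact smul_inv_smul₀ hd0.ne' _
    show m + d • u = G α R v (m + d • u)
    conv_lhs => rw [h]
    abel

end MultilinearPageRank

theorem mainTheorem2 {n : ℕ} (α : ℝ) (hα : α ∈ Set.Ioo (0 : ℝ) 1)
    (R : Matrix (Fin n) (Fin n × Fin n) ℝ) (v : Fin n → ℝ)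
    (hv : MultilinearPageRank.IsStochastic v)
    (hR : ∀ i p, 0 ≤ R i p) (hR1 : 1 ᵥ* R = 1) :
    ∃ m : Fin n → ℝ, MultilinearPageRank.IsMinimalNonnegSolution α R v m ∧
      (α ≤ 1 / 2 →
        MultilinearPageRank.IsStochastic m ∧
        ∀ s : Fin n → ℝ, MultilinearPageRank.IsStochastic s →
          MultilinearPageRank.IsSolution α R v s → s = m) ∧
      (1 / 2 < α →
        1 ⬝ᵥ m = (1 - α) / α ∧ (1 - α) / α < 1 ∧
        ∃ s : Fin n → ℝ, MultilinearPageRank.IsStochastic s ∧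
          MultilinearPageRank.IsSolution α R v s ∧ m ≤ s) := by
  have hα0 := hα.1
  have hv1 : ∑ i, v i = 1 := by simpa [dotProduct] using hv.2
  obtain ⟨m, hm, hle1, hle2⟩ :=
    MultilinearPageRank.exists_isMinimalNonnegSolution hα hv hR hR1
  have hsum := MultilinearPageRank.sum_eq_of_isSolution hα0 hv1 hR1 hm.1.2
  refine ⟨m, hm, fun h => ?_, fun h => ?_⟩
  · have h1 : 1 ≤ (1 - α) / α := by
      rw [le_div_iff₀ hα0]
      linarith
    have hm1 : ∑ i, m i = 1 := by
      rcases hsum with h2 | h2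
      · exact h2
      · exact le_antisymm hle1 (h2 ▸ h1)
    refine ⟨⟨hm.1.1, by simpa [dotProduct] using hm1⟩, fun s hs hsol => ?_⟩
    have hs1 : ∑ i, s i = 1 := by simpa [dotProduct] using hs.2
    have hms : m ≤ s := hm.2 ⟨hs.1, hsol⟩
    -- Entrywise `m ≤ s` with equal sums leaves no room for a strict inequality.
    funext i
    exact ((Finset.sum_eq_sum_iff_of_le fun i _ => hms i).1 (hm1.trans hs1.symm) i
      (Finset.mem_univ i)).symm
  · have h1 : (1 - α) / α < 1 := by
      rw [div_lt_one hα0]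
      linarith
    have hm1 : ∑ i, m i = (1 - α) / α := by
      rcases hsum with h2 | h2
      · exact absurd (h2 ▸ hle2) (not_le.2 h1)
      · exact h2
    exact ⟨by simpa [dotProduct] using hm1, h1,
      MultilinearPageRank.exists_isStochastic_isSolution_ge hα hv hR hR1 hm.1.1 hm.1.2
        (hm1 ▸ h1)⟩
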